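/- Theorem 3.3 (Arf invariant of $C(m,n)$). Let $m,n$ be nonzero integers with $mn>0$, not both odd, and let $C(m,n)$ be the 2-bridge knot with this Conway notation, given by its standard alternating diagram: a horizontal twist tangle with $|m|$ crossings joined to a vertical twist tangle with $|n|$ crossings. With either orientation of the knot, its Arf invariant $\mathrm{Arf}(C(m,n))\in\mathbb{Z}/2$ is as follows. 1. Suppose exactly one of $m,n$ is even; say $n$ is even and $m$ is odd. - (a) If $n\equiv 0\pmod 4$, then $\mathrm{Arf}(C(m,n))=0$ if $\frac n2\equiv 0\pmod 4$, and $\mathrm{Arf}(C(m,n))=1$ if $\frac n2\equiv 2\pmod 4$. - (b) If $n\equiv 2\pmod 4$, then $\mathrm{Arf}(C(m,n))=0$ if $m+\frac n2\equiv 0\pmod 4$, and $\mathrm{Arf}(C(m,n))=1$ if $m+\frac n2\equiv 2\pmod 4$. If instead $m$ is even and $n$ is odd, the same holds with $m$ and $n$ exchanged in the conditions. 2. Suppose both $m$ and $n$ are even. - (a) If $n\equiv 0\pmod 4$, then $\mathrm{Arf}(C(m,n))=0$. - (b) If $n\equiv 2\pmod 4$, then $\mathrm{Arf}(C(m,n))=0$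 if $m\equiv 0\pmod 4$, and $\mathrm{Arf}(C(m,n))=1$ if $m\equiv 2\pmod 4$. Here the Arf invariant is that of the mod 2 quadratic form $q(x)=\mathrm{lk}(x,x^+)\bmod 2$ on $H_1(F;\mathbb{Z}/2)$, where $F$ is the Seifert surface obtained from the diagram by Seifert's algorithm and $x^+$ is the push-off of $x$ in the positive normal direction. -/

import Mathlib

/-!
Link diagrams on the oriented sphere are given as combinatorial maps.  Every crossing `c` has four
ends `(c, 0), (c, 1), (c, 2), (c, 3)`, listed counterclockwise, so that one strand joins the ends
`0` and `2` and the other one joins the ends `1` and `3`.  The edges of the diagram are recorded by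
the involution `mate` that exchanges the two ends of each edge.
-/

/-- A connected link diagram on the sphere with a finite set `V` of crossings.  The corner between
the ends `k` and `k + 1` of `c` is also denoted `(c, k)`; the next corner of the same region is
`mate (c, k + 1)`.  The field `euler` is Euler's formula `|V| - 2 |V| + (number of regions) = 2`,
which says that the projection is drawn on the sphere. -/
structure LinkDiagram (V : Type*) [Fintype V] where
  /-- the other end of the edge which starts at the given end -/
  mate : V × Fin 4 → V × Fin 4
  mate_mate : ∀ d, mate (mate d) = d
  mate_ne : ∀ d, mate d ≠ d
  /-- `true` if the strand joining the ends `1` and `3` passes over, `false` if the strand joining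
  the ends `0` and `2` passes over -/
  overOdd : V → Bool
  connected : ∀ c c' : V, Relation.ReflTransGen (fun x y => ∃ k, (mate (x, k)).1 = y) c c'
  euler : Nat.card (Quot fun d d' : V × Fin 4 => d' = mate (d.1, d.2 + 1)) = Fintype.card V + 2

namespace LinkDiagram

variable {V : Type*} [Fintype V]

/-- Whether the end `k` of the crossing `c` belongs to the strand passing over. -/
def isOver (D : LinkDiagram V) (c : V) (k : Fin 4) : Bool :=
  if k = 1 ∨ k = 3 then D.overOdd c else !D.overOdd c

/-- An orientation of all components: `out d` says that the strand leaves the crossing through the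
end `d`.  A strand which leaves a crossing at one end enters it at the opposite end, and of the two
ends of an edge exactly one is an outgoing one. -/
structure Orientation (D : LinkDiagram V) where
  out : V × Fin 4 → Bool
  out_opposite : ∀ c k, out (c, k + 2) = !out (c, k)
  out_mate : ∀ d, out (D.mate d) = !out d

namespace Orientation

variable {D : LinkDiagram V} (o : D.Orientation)

/-- The two outgoing ends of a crossing are neighbours.  Looking in the direction of the flow, this
is the left one of them; the left incoming end is `leftOut c + 1`.  The oriented smoothing at `c`
joins these two ends (left arc), and it joins the other two ends (right arc). -/
def leftOut (c : V) : Fin 4 :=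
  if o.out (c, 0) then (if o.out (c, 1) then 1 else 0) else (if o.out (c, 1) then 2 else 3)

/-- Let `F` be the surface obtained by Seifert's algorithm: disjoint discs bounded by the Seifert
circles, and a half-twisted band at every crossing, from the left arc to the right arc of the
smoothing.  The edges of the diagram, the smoothing arcs and the cores of the bands form a
trivalent graph on `F`, and its 1-cycles modulo 2 represent all of `H₁(F; ℤ/2)`, the classes being
represented uniquely up to sums of Seifert circles.  Such a cycle is recorded by its coefficients
`z d = z (mate d)` on the edges.  The coefficient of the band at `c` is then the sum of the
coefficients at the two ends of the left arc, and also the sum at the two ends of the right arc;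
`z` is a cycle when these two sums agree. -/
def IsCycle (_o : D.Orientation) (z : V × Fin 4 → ZMod 2) : Prop :=
  (∀ d, z (D.mate d) = z d) ∧ ∀ c, z (c, 0) + z (c, 1) + z (c, 2) + z (c, 3) = 0

/-- The coefficient of the band at the crossing `c` in the cycle `z`. -/
def band (z : V × Fin 4 → ZMod 2) (c : V) : ZMod 2 :=
  z (c, o.leftOut c) + z (c, o.leftOut c + 1)

/-- The end of the left arc at `c` that belongs to the strand passing under: it is the outgoing end
of the left arc at a positive crossing and its incoming end at a negative crossing. -/
def leftUnder (c : V) : Fin 4 :=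
  if D.isOver c (o.leftOut c) then o.leftOut c + 1 else o.leftOut c

/-- The quadratic form `q(z) = lk(z, z⁺) mod 2` of the Seifert surface, where `z⁺` is `z` pushed
off `F` in the positive normal direction.  Near the Seifert circles take `F` to be a vertical
collar, so that `z⁺` is `z` pushed to the left of the oriented circles.  On a band at `c`, `z⁺`
runs above the core of the band at the left arc, passes around it on the side to which the
half-twist turns the normal (the outgoing side for a positive crossing, the incoming side for a
negative one) and is below the core at the right arc.  Thus `z⁺` passes over `z` exactly where `z`
contains both the band at `c` and the part of the left arc on that side, and the linking number
modulo 2 is the number of these places. -/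
def seifertForm (z : V × Fin 4 → ZMod 2) : ZMod 2 :=
  ∑ c, o.band z c * z (c, o.leftUnder c)

/-- The Arf invariant of the quadratic form of the Seifert surface: the value that `q` takes on the
majority of the elements of `H₁(F; ℤ/2)`.  Every class is represented by the same number of cycles,
and `q` depends on the class only, so that the majority may be taken over the cycles.  (For a knot
`q` is nonsingular and there is always a strict majority.) -/
noncomputable def arf : ZMod 2 :=
  if Nat.card {z // o.IsCycle z ∧ o.seifertForm z = 0} <
      Nat.card {z // o.IsCycle z ∧ o.seifertForm z = 1} then 1 else 0

end Orientation

end LinkDiagram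

/-- The edges of the standard diagram with a horizontal row of `a` crossings (from left to right)
and a vertical column of `b` crossings (from top to bottom), the column standing above the row.
The ends of each crossing are `0` = SE, `1` = NE, `2` = NW, `3` = SW.  Neighbours in the row are
joined NE-NW and SE-SW, neighbours in the column SW-NW and SE-NE.  The lower ends of the column are
joined to the upper ends of the row, and the upper ends of the column to the lower ends of the row
by arcs around the left and the right of the picture. -/
def conwayMate (a b : ℕ) (ha : 0 < a) (hb : 0 < b) :
    (Fin a ⊕ Fin b) × Fin 4 → (Fin a ⊕ Fin b) × Fin 4
  | (.inl i, 0) => if h : i.1 + 1 < a then (.inl ⟨i.1 + 1, h⟩, 3) else (.inr ⟨0, hb⟩, 1)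
  | (.inl i, 1) => if h : i.1 + 1 < a then (.inl ⟨i.1 + 1, h⟩, 2) else (.inr ⟨b - 1, by omega⟩, 0)
  | (.inl i, 2) => if i.1 = 0 then (.inr ⟨b - 1, by omega⟩, 3) else (.inl ⟨i.1 - 1, by omega⟩, 1)
  | (.inl i, 3) => if i.1 = 0 then (.inr ⟨0, hb⟩, 2) else (.inl ⟨i.1 - 1, by omega⟩, 0)
  | (.inr j, 0) => if h : j.1 + 1 < b then (.inr ⟨j.1 + 1, h⟩, 1) else (.inl ⟨a - 1, by omega⟩, 1)
  | (.inr j, 1) => if j.1 = 0 then (.inl ⟨a - 1, by omega⟩, 0) else (.inr ⟨j.1 - 1, by omega⟩, 0)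
  | (.inr j, 2) => if j.1 = 0 then (.inl ⟨0, ha⟩, 3) else (.inr ⟨j.1 - 1, by omega⟩, 3)
  | (.inr j, 3) => if h : j.1 + 1 < b then (.inr ⟨j.1 + 1, h⟩, 2) else (.inl ⟨0, ha⟩, 2)

theorem conwayMate_mate (a b : ℕ) (ha : 0 < a) (hb : 0 < b) (d : (Fin a ⊕ Fin b) × Fin 4) :
    conwayMate a b ha hb (conwayMate a b ha hb d) = d := by
  obtain ⟨c | c, k⟩ := d <;> fin_cases k <;>
    (simp only [conwayMate, Fin.reduceFinMk, Fin.zero_eta, Fin.mk_one]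
     split_ifs <;> simp only [conwayMate] <;> split_ifs <;> simp [Fin.ext_iff] <;> omega)

theorem conwayMate_ne (a b : ℕ) (ha : 0 < a) (hb : 0 < b) (d : (Fin a ⊕ Fin b) × Fin 4) :
    conwayMate a b ha hb d ≠ d := by
  obtain ⟨c | c, k⟩ := d <;> fin_cases k <;>
    (simp only [conwayMate]; split_ifs <;> simp [Fin.ext_iff])

theorem conwayMate_connected (a b : ℕ) (ha : 0 < a) (hb : 0 < b) (c c' : Fin a ⊕ Fin b) :
    Relation.ReflTransGen (fun x y => ∃ k, (conwayMate a b ha hb (x, k)).1 = y) c c' := by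
  have hsymm : ∀ x y, Relation.ReflTransGen
      (fun x y => ∃ k, (conwayMate a b ha hb (x, k)).1 = y) x y → Relation.ReflTransGen
      (fun x y => ∃ k, (conwayMate a b ha hb (x, k)).1 = y) y x := by
    intro x y h
    induction h with
    | refl => exact .refl
    | tail _ h ih =>
      rename_i y _ _
      obtain ⟨k, rfl⟩ := h
      refine .head ⟨(conwayMate a b ha hb (y, k)).2, ?_⟩ ih
      rw [Prod.mk.eta, conwayMate_mate]
  have hrow : ∀ (i : ℕ) (hi : i < a), Relation.ReflTransGen
      (fun x y => ∃ k, (conwayMate a b ha hb (x, k)).1 = y) (.inl ⟨i, hi⟩) (.inl ⟨0, ha⟩) := by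
    intro i
    induction i with
    | zero => intro _; exact .refl
    | succ i ih => intro hi; exact .head ⟨2, by simp [conwayMate]⟩ (ih (by omega))
  have hcol : ∀ (j : ℕ) (hj : j < b), Relation.ReflTransGen
      (fun x y => ∃ k, (conwayMate a b ha hb (x, k)).1 = y) (.inr ⟨j, hj⟩) (.inl ⟨0, ha⟩) := by
    intro j
    induction j with
    | zero => intro _; exact .single ⟨2, by simp [conwayMate]⟩
    | succ j ih => intro hj; exact .head ⟨2, by simp [conwayMate]⟩ (ih (by omega))
  have hall : ∀ x, Relation.ReflTransGen
      (fun x y => ∃ k, (conwayMate a b ha hb (x, k)).1 = y) x (.inl ⟨0, ha⟩) := by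
    rintro (⟨i, hi⟩ | ⟨j, hj⟩)
    · exact hrow i hi
    · exact hcol j hj
  exact (hall c).trans (hsymm _ _ (hall c'))

/-- The region containing a corner: the regions between the crossings of the row are numbered from
left to right, those between the crossings of the column from top to bottom. -/
def conwayRegion (a b : ℕ) : (Fin a ⊕ Fin b) × Fin 4 → Fin (a + 1) ⊕ Fin (b + 1)
  | (.inl i, 0) => .inl i.succ
  | (.inl _, 1) => .inr (Fin.last b)
  | (.inl i, 2) => .inl i.castSucc
  | (.inl _, 3) => .inr 0
  | (.inr _, 0) => .inl (Fin.last a)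
  | (.inr j, 1) => .inr j.castSucc
  | (.inr _, 2) => .inl 0
  | (.inr j, 3) => .inr j.succ

theorem conwayMate_euler (a b : ℕ) (ha : 0 < a) (hb : 0 < b) :
    Nat.card (Quot fun d d' : (Fin a ⊕ Fin b) × Fin 4 =>
      d' = conwayMate a b ha hb (d.1, d.2 + 1)) = Fintype.card (Fin a ⊕ Fin b) + 2 := by
  set r := fun d d' : (Fin a ⊕ Fin b) × Fin 4 => d' = conwayMate a b ha hb (d.1, d.2 + 1) with hr
  have step : ∀ d d', d' = conwayMate a b ha hb (d.1, d.2 + 1) → Quot.mk r d = Quot.mk r d' :=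
    fun d d' h => Quot.sound h
  let rep : Fin (a + 1) ⊕ Fin (b + 1) → (Fin a ⊕ Fin b) × Fin 4
    | .inl i => if h : i.1 < a then (.inl ⟨i.1, h⟩, 2) else (.inl ⟨a - 1, by omega⟩, 0)
    | .inr j => if h : j.1 < b then (.inr ⟨j.1, h⟩, 1) else (.inr ⟨b - 1, by omega⟩, 3)
  have hlab : ∀ d d', r d d' → conwayRegion a b d = conwayRegion a b d' := by
    rintro ⟨c | c, k⟩ d' rfl <;> fin_cases k <;>
      (simp only [conwayMate, Fin.reduceAdd, Fin.reduceFinMk, Fin.zero_eta, Fin.mk_one, zero_add]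
       split_ifs <;> simp [conwayRegion, Fin.ext_iff] <;> omega)
  have hrep : ∀ s, conwayRegion a b (rep s) = s := by
    rintro (i | j) <;> simp only [rep] <;> split_ifs <;>
      simp [conwayRegion, Fin.ext_iff] <;> omega
  have rowN : ∀ (i : ℕ) (hi : i < a),
      Quot.mk r (.inl ⟨i, hi⟩, 1) = Quot.mk r (.inr ⟨b - 1, by omega⟩, 3) := by
    intro i
    induction i with
    | zero => intro hi; exact step _ _ (by simp [conwayMate])
    | succ i ih =>
      intro hi
      rw [← ih (by omega)]; exact step _ _ (by simp [conwayMate])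
  have rowS : ∀ (t i : ℕ) (hi : i < a), a = i + 1 + t →
      Quot.mk r (.inl ⟨i, hi⟩, 3) = Quot.mk r (.inr ⟨0, hb⟩, 1) := by
    intro t
    induction t with
    | zero => intro i hi h; exact step _ _ (by simp [conwayMate]; omega)
    | succ t ih =>
      intro i hi h
      rw [← ih (i + 1) (by omega) (by omega)]
      exact step _ _ (by have h2 : i + 1 < a := by omega
                         simp [conwayMate, h2])
  have colE : ∀ (j : ℕ) (hj : j < b),
      Quot.mk r (.inr ⟨j, hj⟩, 0) = Quot.mk r (.inl ⟨a - 1, by omega⟩, 0) := by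
    intro j
    induction j with
    | zero => intro hj; exact step _ _ (by simp [conwayMate])
    | succ j ih =>
      intro hj
      rw [← ih (by omega)]; exact step _ _ (by simp [conwayMate])
  have colW : ∀ (t j : ℕ) (hj : j < b), b = j + 1 + t →
      Quot.mk r (.inr ⟨j, hj⟩, 2) = Quot.mk r (.inl ⟨0, ha⟩, 2) := by
    intro t
    induction t with
    | zero => intro j hj h; exact step _ _ (by simp [conwayMate]; omega)
    | succ t ih =>
      intro j hj h
      rw [← ih (j + 1) (by omega) (by omega)]
      exact step _ _ (by have h2 : j + 1 < b := by omega
                         simp [conwayMate, h2])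
  have key : ∀ d, Quot.mk r (rep (conwayRegion a b d)) = Quot.mk r d := by
    rintro ⟨⟨i, hi⟩ | ⟨j, hj⟩, k⟩ <;> fin_cases k
    · by_cases h : i + 1 < a
      · simp only [rep, conwayRegion, Fin.zero_eta, Fin.val_succ, h, dif_pos]
        exact (step _ _ (by simp [conwayMate, h])).symm
      · have : i = a - 1 := by omega
        subst this
        simp [rep, conwayRegion, h]
    · simpa [rep, conwayRegion] using (rowN i hi).symm
    · simp [rep, conwayRegion, hi]
    · simpa [rep, conwayRegion, hb] using (rowS (a - 1 - i) i hi (by omega)).symm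
    · simpa [rep, conwayRegion] using (colE j hj).symm
    · simp [rep, conwayRegion, hj]
    · simpa [rep, conwayRegion, ha] using (colW (b - 1 - j) j hj (by omega)).symm
    · by_cases h : j + 1 < b
      · simp only [rep, conwayRegion, Fin.reduceFinMk, Fin.val_succ, h, dif_pos]
        exact (step _ _ (by simp [conwayMate, h])).symm
      · have : j = b - 1 := by omega
        subst this
        simp [rep, conwayRegion, h]
  let e : Quot r ≃ Fin (a + 1) ⊕ Fin (b + 1) :=
    { toFun := Quot.lift (conwayRegion a b) hlab
      invFun := fun s => Quot.mk r (rep s)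
      left_inv := by rintro ⟨d⟩; exact key d
      right_inv := fun s => hrep s }
  rw [Nat.card_congr e]
  simp
  omega

/-- The diagram `C(m, n)` for nonzero integers `m` and `n`: a horizontal integer tangle of `|m|`
crossings and a vertical integer tangle of `|n|` crossings.  In a tangle with a positive number of
half-twists the overcrossing strands go from SW to NE; for a negative number the crossings are
switched.  The diagram is alternating if `m n > 0`; it is a knot diagram if and only if `m` or `n`
is even. -/
def conwayDiagram (m n : ℤ) (hm : m ≠ 0) (hn : n ≠ 0) :
    LinkDiagram (Fin m.natAbs ⊕ Fin n.natAbs) where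
  mate := conwayMate _ _ (Int.natAbs_pos.2 hm) (Int.natAbs_pos.2 hn)
  mate_mate := conwayMate_mate _ _ _ _
  mate_ne := conwayMate_ne _ _ _ _
  overOdd
    | .inl _ => decide (0 < m)
    | .inr _ => decide (0 < n)
  connected := conwayMate_connected _ _ _ _
  euler := conwayMate_euler _ _ _ _

/-!
The Arf invariant of a quadratic form `q` over `ZMod 2` is the exponent of the sign of its Gauss sum
`∑ z, (-1) ^ q z`.  The sum may be taken over the cycles of the diagram, and for `C(m, n)` it
becomes a small state sum.  A cycle is given by its coefficients `s` along one side of the row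
and `l` along one side of the column, subject to `s 0 = l 0` (`isCycle_pathCycle`,
`exists_pathCycle`): the two coefficients at the same place of a twist differ by a constant, which is
determined by the ends of the other twist.  The form is a sum of contributions of the crossings, each
depending on two consecutive coefficients, so the sum over the interior coefficients of a twist is a
product of `2 × 2` transfer matrices (`sum_paths`).

The orientation of a twist is either antiparallel or parallel.  Antiparallel twists have matrices
that are characters of the end coefficients (`twistMatrix_antiparallel_odd`,
`twistMatrix_antiparallel_even`).  For parallel strands two consecutive crossings give twice a signed
permutation matrix of square `-1` (`twistMatrix_parallel`).  If `m` and `n` are even, both twists are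
antiparallel; if only one of them is even, the twist with an even number of crossings is the parallel
one (`out_closing_arcs`).  What remains is a sum over three coefficients.  It shows that
the Arf invariant is `(m / 2) (n / 2)` if both numbers are even (`arf_even_even`), and
`h (k + 1) + h.choose 2` if `|m| = 2 k + 1` and `|n| = 2 h` (`arf_odd_even`), modulo `2`.
-/

/-! ### Transfer matrices of twists -/

/-- The nontrivial character of `ZMod 2` with values `1` and `-1`. -/
def signChar (x : ZMod 2) : ℤ := if x = 0 then 1 else -1

theorem signChar_add (x y : ZMod 2) : signChar (x + y) = signChar x * signChar y := by
  revert x y; decide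

theorem signChar_sum {ι : Type*} (t : Finset ι) (f : ι → ZMod 2) :
    signChar (∑ i ∈ t, f i) = ∏ i ∈ t, signChar (f i) := by
  classical
  induction t using Finset.induction_on with
  | empty => simp [signChar]
  | insert i t hi ih => rw [Finset.sum_insert hi, Finset.prod_insert hi, signChar_add, ih]

/-- The contribution of one crossing of a twist to the Seifert form.  The crossing has its ends `3`
and `2` at the start of the twist and its ends `0` and `1` at the end of it (a column is brought
into this position by a quarter turn, which switches the crossing).  The cycle has coefficients `s`
and `s + u` at the ends `3` and `2`, and `s'` and `s' + u` at the ends `0` and `1`; the strands leave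
the crossing through the ends `3` and `2` if `α` and `β`, respectively, are `true`; and `e` says that
the strand joining the ends `1` and `3` passes over. -/
def crossingTerm (e α β : Bool) (u s s' : ZMod 2) : ZMod 2 :=
  if α then (if β then (s + s') * (if e then s' else s) else u * (if e then s' else s' + u))
  else (if β then u * (if e then s + u else s) else (s + s') * (if e then s + u else s' + u))

/-- The transfer matrix of a twist of `k` crossings, with entries indexed by the coefficients `x` and
`y` at the two ends of one side: the sum of `(-1) ^ q` over all coefficients in between.  The
arguments are as in `crossingTerm` for the first crossing; the strands change sides at every
crossing, so that `α` and `β` are exchanged from one crossing to the next. -/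
def twistMatrix (e : Bool) (u : ZMod 2) :
    Bool → Bool → ℕ → ZMod 2 → ZMod 2 → ℤ
  | _, _, 0, x, y => if x = y then 1 else 0
  | α, β, k + 1, x, y =>
    ∑ w : ZMod 2, signChar (crossingTerm e α β u x w) * twistMatrix e u β α k w y

/-- The sequence `α, β, α, β, …`. -/
def alternate (α β : Bool) (i : ℕ) : Bool := if Even i then α else β

theorem alternate_succ (α β : Bool) (i : ℕ) : alternate α β (i + 1) = alternate β α i := by
  simp only [alternate, Nat.even_add_one]; split_ifs <;> simp_all

/-- Summing over the coefficients along one side of a twist gives the transfer matrix; the weight `G`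
of the two extreme coefficients couples the twist to the rest of the diagram. -/
theorem sum_paths (e : Bool) (u : ZMod 2) (k : ℕ) (α β : Bool) (G : ZMod 2 → ZMod 2 → ℤ) :
    ∑ s : Fin (k + 1) → ZMod 2, G (s 0) (s (Fin.last k)) * ∏ i : Fin k,
        signChar (crossingTerm e (alternate α β i) (alternate β α i) u (s i.castSucc) (s i.succ)) =
      ∑ x, ∑ y, G x y * twistMatrix e u α β k x y := by
  induction k generalizing α β G with
  | zero =>
    rw [← (Equiv.funUnique (Fin 1) (ZMod 2)).symm.sum_comp]
    simp [twistMatrix]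
  | succ k ih =>
    rw [← (Fin.consEquiv fun _ : Fin (k + 2) => ZMod 2).sum_comp, Fintype.sum_prod_type]
    refine Finset.sum_congr rfl fun x _ => ?_
    have h := ih β α fun w y => G x y * signChar (crossingTerm e α β u x w)
    simp only [Fin.consEquiv_apply, Fin.prod_univ_succ, Fin.cons_zero, Fin.cons_succ,
      Fin.castSucc_zero, ← Fin.succ_castSucc, ← Fin.succ_last, Fin.val_succ, alternate_succ,
      Fin.val_zero] at h ⊢
    simp only [show alternate α β 0 = α by simp [alternate],
      show alternate β α 0 = β by simp [alternate], ← mul_assoc]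
    rw [h, Finset.sum_comm]
    simp only [twistMatrix, Finset.mul_sum, mul_assoc]

theorem sum_zmod_two (f : ZMod 2 → ℤ) : ∑ x, f x = f 0 + f 1 := Fin.sum_univ_two f

theorem twistMatrix_two_steps (e : Bool) (u : ZMod 2) (α β : Bool) (k : ℕ) (x y : ZMod 2) :
    twistMatrix e u α β (k + 2) x y = ∑ w, (∑ p, signChar (crossingTerm e α β u x p +
      crossingTerm e β α u p w)) * twistMatrix e u α β k w y := by
  simp only [twistMatrix, Finset.mul_sum, Finset.sum_mul, signChar_add, mul_assoc]
  exact Finset.sum_comm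

/-- For antiparallel strands the band coefficient of every crossing is `u`, and the
coefficients multiplied by it pair up to sums `u`, apart from those at the ends of the twist. -/
theorem twistMatrix_antiparallel_odd (e : Bool) (u : ZMod 2) (α : Bool) (k : ℕ) (x y : ZMod 2) :
    twistMatrix e u α (!α) (2 * k + 1) x y =
      4 ^ k * signChar (u * (k + (if α then y else x) + if e = α then 0 else 1)) := by
  induction k generalizing x with
  | zero =>
    simp only [twistMatrix, sum_zmod_two]
    revert e u α x y; decide
  | succ k ih =>
    rw [show 2 * (k + 1) + 1 = 2 * k + 1 + 2 by ring, twistMatrix_two_steps, sum_zmod_two, ih, ih,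
      Nat.cast_succ, pow_succ]
    generalize (k : ZMod 2) = K
    generalize (4 : ℤ) ^ k = c
    simp only [mul_left_comm _ c, ← mul_add, mul_assoc]
    congr 1
    clear ih
    revert e u α x y K; decide

theorem twistMatrix_antiparallel_even (e : Bool) (u : ZMod 2) (α : Bool) (k : ℕ) (x y : ZMod 2) :
    twistMatrix e u α (!α) (2 * k + 2) x y =
      4 ^ k * (2 * signChar (u * (k + 1 + if α then 0 else x + y))) := by
  induction k generalizing x with
  | zero =>
    simp only [twistMatrix, sum_zmod_two]
    revert e u α x y; decide
  | succ k ih =>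
    rw [show 2 * (k + 1) + 2 = 2 * k + 2 + 2 by ring, twistMatrix_two_steps, sum_zmod_two, ih, ih,
      Nat.cast_succ, pow_succ]
    generalize (k : ZMod 2) = K
    generalize (4 : ℤ) ^ k = c
    simp only [mul_left_comm _ c, ← mul_add, mul_assoc]
    congr 1
    clear ih
    revert e u α x y K; decide

/-- For parallel strands two crossings have a matrix that is twice a signed permutation matrix whose
square is `-1`.  The resulting period four in `h`, half the number of crossings, is the source of
the condition on `n / 2` modulo `4` in the odd-even case. -/
theorem twistMatrix_parallel (e : Bool) (u : ZMod 2) (α : Bool) (h : ℕ) (x y : ZMod 2) :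
    twistMatrix e u α α (2 * h) x y = 2 ^ h * if x + y = h then
      signChar (h * (x + (if α then 0 else u) + if e = α then 1 else 0) + h.choose 2) else 0 := by
  induction h generalizing x with
  | zero =>
    simp only [twistMatrix]
    revert e u α x y; decide
  | succ h ih =>
    rw [show 2 * (h + 1) = 2 * h + 2 by ring, twistMatrix_two_steps, sum_zmod_two, ih, ih,
      Nat.cast_succ, pow_succ, Nat.choose_succ_succ' h 1, Nat.choose_one_right, Nat.cast_add]
    generalize (h : ZMod 2) = K
    generalize (h.choose 2 : ZMod 2) = C
    generalize (2 : ℤ) ^ h = c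
    simp only [mul_left_comm _ c, ← mul_add, mul_assoc]
    congr 1
    clear ih
    revert e u α x y K C; decide

/-! ### The Gauss sum -/

/-- The sum of `(-1) ^ q` over the cycles of the standard diagram with `a` crossings in the row and
`b` crossings in the column, in terms of transfer matrices.  Here `x`, `y` and `z` are the
coefficients on the edge from the lower left end of the row to the upper left end of the column, at
the lower right end of the row and at the lower left end of the column. -/
def twistGaussSum (e α β β' : Bool) (a b : ℕ) : ℤ :=
  ∑ x, ∑ y, ∑ z, twistMatrix e (x + z) α β a x y * twistMatrix (!e) (x + y) (!α) β' b x z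

/-- Row and column play the same role, up to switching all crossings. -/
theorem twistGaussSum_comm (e α β β' : Bool) (a b : ℕ) :
    twistGaussSum e α β β' a b = twistGaussSum (!e) (!α) β' β b a := by
  simp only [twistGaussSum, Bool.not_not]
  refine Finset.sum_congr rfl fun x _ => ?_
  rw [Finset.sum_comm]
  simp only [mul_comm]

theorem twistGaussSum_even_even (e α : Bool) (k h : ℕ) :
    ∃ c > 0, twistGaussSum e α (!α) α (2 * k + 2) (2 * h + 2) =
      c * signChar ((k + 1) * (h + 1)) := by
  refine ⟨4 ^ k * 4 ^ h * 16, by positivity, ?_⟩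
  have h' := fun u x z => twistMatrix_antiparallel_even (!e) u (!α) h x z
  simp only [Bool.not_not] at h'
  simp only [twistGaussSum, twistMatrix_antiparallel_even, h']
  generalize (k : ZMod 2) = K
  generalize (h : ZMod 2) = H
  generalize (4 : ℤ) ^ k = c
  generalize (4 : ℤ) ^ h = d
  simp only [mul_assoc, mul_left_comm _ d, ← Finset.mul_sum]
  congr 2
  clear h'
  revert e α K H; decide

theorem twistGaussSum_odd_even (e α : Bool) (k h : ℕ) :
    ∃ c > 0, twistGaussSum e α (!α) (!α) (2 * k + 1) (2 * h) =
      c * signChar (h * (k + 1) + h.choose 2) := by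
  refine ⟨4 ^ k * 2 ^ h * 4, by positivity, ?_⟩
  simp only [twistGaussSum, twistMatrix_antiparallel_odd, twistMatrix_parallel]
  generalize (k : ZMod 2) = K
  generalize (h.choose 2 : ZMod 2) = C
  generalize (h : ZMod 2) = H
  generalize (4 : ℤ) ^ k = c
  generalize (2 : ℤ) ^ h = d
  simp only [mul_assoc, mul_left_comm _ d, ← Finset.mul_sum]
  congr 2
  revert e α K H C; decide

/-! ### Cycles of the standard diagram -/

namespace LinkDiagram

/-- The sign of the Gauss sum tells which value the quadratic form takes more often. -/
theorem Orientation.arf_eq_of_sum {V : Type*} [Fintype V] {D : LinkDiagram V}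
    (o : D.Orientation) {ι : Type*} [Fintype ι] (f : ι ≃ {z // o.IsCycle z}) {c : ℤ} (hc : 0 < c)
    {E : ZMod 2} (h : ∑ i, signChar (o.seifertForm (f i).1) = c * signChar E) : o.arf = E := by
  classical
  have hsum : ∑ z : {z // o.IsCycle z}, signChar (o.seifertForm z.1) =
      (Nat.card {z // o.IsCycle z ∧ o.seifertForm z = 0} : ℤ) -
        Nat.card {z // o.IsCycle z ∧ o.seifertForm z = 1} := by
    have hcard : ∀ t : ZMod 2, (Nat.card {z // o.IsCycle z ∧ o.seifertForm z = t} : ℤ) =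
        ∑ z : {z // o.IsCycle z}, if o.seifertForm z.1 = t then 1 else 0 := by
      intro t
      rw [Finset.sum_boole, ← Fintype.card_subtype, ← Nat.card_eq_fintype_card]
      exact congrArg _ (Nat.card_congr (Equiv.subtypeSubtypeEquivSubtypeInter _ _).symm)
    rw [hcard, hcard, ← Finset.sum_sub_distrib]
    refine Finset.sum_congr rfl fun z _ => ?_
    generalize o.seifertForm z.1 = t
    revert t; decide
  rw [f.sum_comp fun z => signChar (o.seifertForm z.1), hsum] at h
  unfold Orientation.arf
  have hE : E = 0 ∨ E = 1 := by clear h; revert E; decide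
  obtain rfl | rfl := hE <;> simp [signChar] at h ⊢ <;> omega

variable {a b : ℕ}

/-- The cycle with coefficients `s` along the lower side of the row and `l` along the left side of
the column.  The coefficients on the upper side of the row differ from those on the lower side by a
constant, which is read off at the ends of the column, and likewise with row and column
exchanged. -/
def pathCycle (s : Fin (a + 1) → ZMod 2) (l : Fin (b + 1) → ZMod 2) :
    (Fin a ⊕ Fin b) × Fin 4 → ZMod 2
  | (.inl i, 0) => s i.succ
  | (.inl i, 1) => s i.succ + (l 0 + l (Fin.last b))
  | (.inl i, 2) => s i.castSucc + (l 0 + l (Fin.last b))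
  | (.inl i, 3) => s i.castSucc
  | (.inr j, 0) => l j.succ + (s 0 + s (Fin.last a))
  | (.inr j, 1) => l j.castSucc + (s 0 + s (Fin.last a))
  | (.inr j, 2) => l j.castSucc
  | (.inr j, 3) => l j.succ

variable {D : LinkDiagram (Fin a ⊕ Fin b)} (o : D.Orientation)

theorem isCycle_pathCycle (ha : 0 < a) (hb : 0 < b) (hD : D.mate = conwayMate a b ha hb)
    (s : Fin (a + 1) → ZMod 2) (l : Fin (b + 1) → ZMod 2) (h0 : s 0 = l 0) :
    o.IsCycle (pathCycle s l) := by
  have two : ∀ x y : ZMod 2, x + (x + y) = y ∧ x + (y + x) = y := by decide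
  constructor
  · rw [hD]
    have succ_last : ∀ {n i : ℕ} (hi : i < n), ¬ i + 1 < n →
        (⟨i, hi⟩ : Fin n).succ = Fin.last n := fun hi h => Fin.ext (by simp; omega)
    have pred_last : ∀ {n : ℕ} (hn : n - 1 < n), (⟨n - 1, hn⟩ : Fin n).succ = Fin.last n :=
      fun hn => succ_last hn (by omega)
    have castSucc_zero : ∀ {n : ℕ} (hn : 0 < n), (⟨0, hn⟩ : Fin n).castSucc = 0 := fun _ => rfl
    have pred_succ : ∀ {n i : ℕ} (hi : i < n) (hi' : i - 1 < n), i ≠ 0 →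
        (⟨i - 1, hi'⟩ : Fin n).succ = (⟨i, hi⟩ : Fin n).castSucc :=
      fun hi _ h => Fin.ext (by simp; omega)
    rintro ⟨⟨i, hi⟩ | ⟨j, hj⟩, k⟩
    · fin_cases k <;> simp only [conwayMate, Fin.reduceFinMk, Fin.zero_eta, Fin.mk_one] <;>
        split_ifs with h <;> simp only [pathCycle]
      · rfl
      · rw [succ_last hi h, castSucc_zero, ← h0, (two _ _).1]
      · rfl
      · rw [succ_last hi h, pred_last, h0]
        ring
      · subst h
        rw [castSucc_zero, pred_last, h0, (two _ _).1]
      · rw [pred_succ hi _ h]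
      · subst h
        rw [castSucc_zero, castSucc_zero, h0]
      · rw [pred_succ hi _ h]
    · fin_cases k <;> simp only [conwayMate, Fin.reduceFinMk, Fin.zero_eta, Fin.mk_one] <;>
        split_ifs with h <;> simp only [pathCycle]
      · rfl
      · rw [succ_last hj h, pred_last, h0]
        ring
      · subst h
        rw [castSucc_zero, pred_last, ← h0, (two _ _).1]
      · rw [pred_succ hj _ h]
      · subst h
        rw [castSucc_zero, castSucc_zero, h0]
      · rw [pred_succ hj _ h]
      · rfl
      · rw [succ_last hj h, castSucc_zero, h0, (two _ _).1]
  · rintro (i | j)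
    · simp only [pathCycle]
      generalize s i.succ = p, s i.castSucc = q, l 0 + l (Fin.last b) = u
      revert p q u; decide
    · simp only [pathCycle]
      generalize l j.succ = p, l j.castSucc = q, s 0 + s (Fin.last a) = u
      revert p q u; decide

theorem pathCycle_injective (ha : 0 < a) (hb : 0 < b) {s s' : Fin (a + 1) → ZMod 2}
    {l l' : Fin (b + 1) → ZMod 2} (h : pathCycle s l = pathCycle s' l') : s = s' ∧ l = l' := by
  constructor
  · funext i
    induction i using Fin.cases with
    | zero => exact congrFun h (.inl ⟨0, ha⟩, 3)
    | succ i => exact congrFun h (.inl i, 0)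
  · funext j
    induction j using Fin.cases with
    | zero => exact congrFun h (.inr ⟨0, hb⟩, 2)
    | succ j => exact congrFun h (.inr j, 3)

/-- The cycle condition makes the sum of the two coefficients constant along each twist, and thus
every cycle comes from its coefficients on one side of each twist. -/
theorem exists_pathCycle (ha : 0 < a) (hb : 0 < b) (hD : D.mate = conwayMate a b ha hb)
    {z : (Fin a ⊕ Fin b) × Fin 4 → ZMod 2} (hz : o.IsCycle z) :
    ∃ (s : Fin (a + 1) → ZMod 2) (l : Fin (b + 1) → ZMod 2), s 0 = l 0 ∧ pathCycle s l = z := by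
  obtain ⟨hm, hc⟩ := hz
  rw [hD] at hm
  have row3 : ∀ i : Fin a, (Fin.cases (z (.inl ⟨0, ha⟩, 3)) (fun i => z (.inl i, 0)) i.castSucc :
      ZMod 2) = z (.inl i, 3) := by
    rintro ⟨_ | i, hi⟩
    · rfl
    · have h := hm (.inl ⟨i + 1, hi⟩, 3)
      simpa [conwayMate] using h
  have column2 : ∀ j : Fin b, (Fin.cases (z (.inr ⟨0, hb⟩, 2)) (fun j => z (.inr j, 3))
      j.castSucc : ZMod 2) = z (.inr j, 2) := by
    rintro ⟨_ | j, hj⟩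
    · rfl
    · have h := hm (.inr ⟨j + 1, hj⟩, 2)
      simpa [conwayMate] using h
  have solve : ∀ p q r t u : ZMod 2, p + q + r + t = 0 →
      (r + t = u → p + q = u) ∧ (q + r = u → p + t = u) := by decide
  have row : ∀ (i : ℕ) (hi : i < a), z (.inl ⟨i, hi⟩, 2) + z (.inl ⟨i, hi⟩, 3) =
      z (.inr ⟨0, hb⟩, 2) + z (.inr ⟨b - 1, by omega⟩, 3) := by
    intro i
    induction i with
    | zero =>
      intro hi
      rw [← hm (.inl ⟨0, hi⟩, 2), ← hm (.inl ⟨0, hi⟩, 3)]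
      simp [conwayMate, add_comm]
    | succ i ih =>
      intro hi
      have h := (solve _ _ _ _ _ (hc (.inl ⟨i, by omega⟩))).1 (ih (by omega))
      rw [← hm (.inl ⟨i + 1, hi⟩, 2), ← hm (.inl ⟨i + 1, hi⟩, 3)]
      simpa [conwayMate, add_comm] using h
  have column : ∀ (j : ℕ) (hj : j < b), z (.inr ⟨j, hj⟩, 1) + z (.inr ⟨j, hj⟩, 2) =
      z (.inl ⟨0, ha⟩, 3) + z (.inl ⟨a - 1, by omega⟩, 0) := by
    intro j
    induction j with
    | zero =>
      intro hj
      rw [← hm (.inr ⟨0, hj⟩, 1), ← hm (.inr ⟨0, hj⟩, 2)]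
      simp [conwayMate, add_comm]
    | succ j ih =>
      intro hj
      have h := (solve _ _ _ _ _ (hc (.inr ⟨j, by omega⟩))).2 (ih (by omega))
      rw [← hm (.inr ⟨j + 1, hj⟩, 1), ← hm (.inr ⟨j + 1, hj⟩, 2)]
      simpa [conwayMate, add_comm] using h
  have row_last : (Fin.cases (z (.inl ⟨0, ha⟩, 3)) (fun i => z (.inl i, 0)) (Fin.last a) :
      ZMod 2) = z (.inl ⟨a - 1, by omega⟩, 0) := by
    rw [show Fin.last a = (⟨a - 1, by omega⟩ : Fin a).succ from Fin.ext (by simp; omega)]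
    rfl
  have column_last : (Fin.cases (z (.inr ⟨0, hb⟩, 2)) (fun j => z (.inr j, 3)) (Fin.last b) :
      ZMod 2) = z (.inr ⟨b - 1, by omega⟩, 3) := by
    rw [show Fin.last b = (⟨b - 1, by omega⟩ : Fin b).succ from Fin.ext (by simp; omega)]
    rfl
  have add_eq : ∀ p q u : ZMod 2, p + q = u → q + u = p ∧ p + u = q := by decide
  have sum_eq : ∀ p q r t u : ZMod 2, p + q + r + t = 0 →
      (r + t = u → p + u = q) ∧ (q + r = u → t + u = p) := by decide
  refine ⟨Fin.cases (z (.inl ⟨0, ha⟩, 3)) (fun i => z (.inl i, 0)),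
    Fin.cases (z (.inr ⟨0, hb⟩, 2)) (fun j => z (.inr j, 3)), ?_, ?_⟩
  · have h := hm (.inl ⟨0, ha⟩, 3)
    simpa [conwayMate] using h.symm
  · funext ⟨c, k⟩
    rcases c with i | j
    · fin_cases k <;> simp only [pathCycle, Fin.reduceFinMk, Fin.zero_eta, Fin.mk_one, row3,
        column_last, Fin.cases_zero, Fin.cases_succ]
      · exact (sum_eq _ _ _ _ _ (hc (.inl i))).1 (row i i.2)
      · exact (add_eq _ _ _ (row i i.2)).1
    · fin_cases k <;> simp only [pathCycle, Fin.reduceFinMk, Fin.zero_eta, Fin.mk_one, column2,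
        row_last, Fin.cases_zero, Fin.cases_succ]
      · exact (sum_eq _ _ _ _ _ (hc (.inr j))).2 (column j j.2)
      · exact (add_eq _ _ _ (column j j.2)).1

theorem out_row (ha : 0 < a) (hb : 0 < b) (hD : D.mate = conwayMate a b ha hb) (i : ℕ)
    (hi : i < a) :
    o.out (.inl ⟨i, hi⟩, 3) = alternate (o.out (.inl ⟨0, ha⟩, 3)) (o.out (.inl ⟨0, ha⟩, 2)) i ∧
    o.out (.inl ⟨i, hi⟩, 2) = alternate (o.out (.inl ⟨0, ha⟩, 2)) (o.out (.inl ⟨0, ha⟩, 3)) i := by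
  induction i with
  | zero => simp [alternate]
  | succ i ih =>
    have ih := ih (by omega)
    have h2 := o.out_mate (.inl ⟨i + 1, hi⟩, 2)
    have h3 := o.out_mate (.inl ⟨i + 1, hi⟩, 3)
    have p0 := o.out_opposite (.inl ⟨i, by omega⟩) 0
    have p1 := o.out_opposite (.inl ⟨i, by omega⟩) 1
    simp only [hD, conwayMate, Nat.add_eq_zero_iff, one_ne_zero, and_false, if_false,
      Nat.add_sub_cancel, zero_add, Fin.reduceAdd] at h2 h3 p0 p1
    rw [alternate_succ, alternate_succ, ← ih.1, ← ih.2]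
    simp_all

theorem out_column (ha : 0 < a) (hb : 0 < b) (hD : D.mate = conwayMate a b ha hb) (j : ℕ)
    (hj : j < b) :
    o.out (.inr ⟨j, hj⟩, 2) = alternate (o.out (.inr ⟨0, hb⟩, 2)) (o.out (.inr ⟨0, hb⟩, 1)) j ∧
    o.out (.inr ⟨j, hj⟩, 1) = alternate (o.out (.inr ⟨0, hb⟩, 1)) (o.out (.inr ⟨0, hb⟩, 2)) j := by
  induction j with
  | zero => simp [alternate]
  | succ j ih =>
    have ih := ih (by omega)
    have h2 := o.out_mate (.inr ⟨j + 1, hj⟩, 2)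
    have h1 := o.out_mate (.inr ⟨j + 1, hj⟩, 1)
    have p0 := o.out_opposite (.inr ⟨j, by omega⟩) 0
    have p1 := o.out_opposite (.inr ⟨j, by omega⟩) 1
    simp only [hD, conwayMate, Nat.add_eq_zero_iff, one_ne_zero, and_false, if_false,
      Nat.add_sub_cancel, zero_add, Fin.reduceAdd] at h2 h1 p0 p1
    rw [alternate_succ, alternate_succ, ← ih.1, ← ih.2]
    simp_all

theorem seifertTerm_row (i : Fin a) (s : Fin (a + 1) → ZMod 2) (l : Fin (b + 1) → ZMod 2) :
    o.band (pathCycle s l) (.inl i) * pathCycle s l (.inl i, o.leftUnder (.inl i)) =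
      crossingTerm (D.overOdd (.inl i)) (o.out (.inl i, 3)) (o.out (.inl i, 2))
        (l 0 + l (Fin.last b)) (s i.castSucc) (s i.succ) := by
  have p0 := o.out_opposite (.inl i) 0
  have p1 := o.out_opposite (.inl i) 1
  simp only [zero_add, Fin.reduceAdd] at p0 p1
  rw [p0, p1]
  unfold Orientation.band Orientation.leftUnder Orientation.leftOut LinkDiagram.isOver
  generalize hs : s i.succ = p
  generalize hs' : s i.castSucc = q
  generalize hu : l 0 + l (Fin.last b) = u
  cases o.out (.inl i, 0) <;> cases o.out (.inl i, 1) <;> cases D.overOdd (.inl i) <;>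
    simp [pathCycle, crossingTerm, hs, hs', hu] <;> clear hs hs' hu <;> revert p q u <;> decide

/-- A quarter turn takes the column into the position of a row, and the strand joining the ends `1`
and `3` into the one joining the ends `0` and `2`; hence the negation of `overOdd`. -/
theorem seifertTerm_column (j : Fin b) (s : Fin (a + 1) → ZMod 2) (l : Fin (b + 1) → ZMod 2) :
    o.band (pathCycle s l) (.inr j) * pathCycle s l (.inr j, o.leftUnder (.inr j)) =
      crossingTerm (!D.overOdd (.inr j)) (o.out (.inr j, 2)) (o.out (.inr j, 1))
        (s 0 + s (Fin.last a)) (l j.castSucc) (l j.succ) := by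
  have p0 := o.out_opposite (.inr j) 0
  simp only [zero_add] at p0
  rw [p0]
  unfold Orientation.band Orientation.leftUnder Orientation.leftOut LinkDiagram.isOver
  generalize hs : l j.succ = p
  generalize hs' : l j.castSucc = q
  generalize hu : s 0 + s (Fin.last a) = u
  cases o.out (.inr j, 0) <;> cases o.out (.inr j, 1) <;> cases D.overOdd (.inr j) <;>
    simp [pathCycle, crossingTerm, hs, hs', hu] <;> clear hs hs' hu <;> revert p q u <;> decide

end LinkDiagram

/-! ### The Arf invariant of the standard diagram -/

namespace LinkDiagram

variable {a b : ℕ} {D : LinkDiagram (Fin a ⊕ Fin b)} (o : D.Orientation)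

theorem signChar_seifertForm_pathCycle (ha : 0 < a) (hb : 0 < b)
    (hD : D.mate = conwayMate a b ha hb) {e : Bool} (he : ∀ c, D.overOdd c = e)
    (s : Fin (a + 1) → ZMod 2) (l : Fin (b + 1) → ZMod 2) :
    signChar (o.seifertForm (pathCycle s l)) =
      (∏ i : Fin a, signChar (crossingTerm e
        (alternate (o.out (.inl ⟨0, ha⟩, 3)) (o.out (.inl ⟨0, ha⟩, 2)) i)
        (alternate (o.out (.inl ⟨0, ha⟩, 2)) (o.out (.inl ⟨0, ha⟩, 3)) i)
        (l 0 + l (Fin.last b)) (s i.castSucc) (s i.succ))) *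
      ∏ j : Fin b, signChar (crossingTerm (!e)
        (alternate (o.out (.inr ⟨0, hb⟩, 2)) (o.out (.inr ⟨0, hb⟩, 1)) j)
        (alternate (o.out (.inr ⟨0, hb⟩, 1)) (o.out (.inr ⟨0, hb⟩, 2)) j)
        (s 0 + s (Fin.last a)) (l j.castSucc) (l j.succ)) := by
  rw [Orientation.seifertForm, signChar_sum, Fintype.prod_sum_type]
  congr 1
  · refine Finset.prod_congr rfl fun i _ => ?_
    rw [seifertTerm_row, he, ← (out_row o ha hb hD i i.2).1, ← (out_row o ha hb hD i i.2).2]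
  · refine Finset.prod_congr rfl fun j _ => ?_
    rw [seifertTerm_column, he, ← (out_column o ha hb hD j j.2).1,
      ← (out_column o ha hb hD j j.2).2]

/-- The Gauss sum over the cycles is `twistGaussSum`, so that its sign determines the Arf
invariant. -/
theorem arf_eq_of_twistGaussSum (ha : 0 < a) (hb : 0 < b)
    (hD : D.mate = conwayMate a b ha hb) {e : Bool} (he : ∀ c, D.overOdd c = e) {E : ZMod 2}
    (hE : ∃ c > 0, twistGaussSum e (o.out (.inl ⟨0, ha⟩, 3)) (o.out (.inl ⟨0, ha⟩, 2))
      (o.out (.inr ⟨0, hb⟩, 1)) a b = c * signChar E) : o.arf = E := by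
  obtain ⟨c, hc, h⟩ := hE
  let f : {p : (Fin (a + 1) → ZMod 2) × (Fin (b + 1) → ZMod 2) // p.1 0 = p.2 0} →
      {z // o.IsCycle z} := fun p =>
    ⟨pathCycle p.1.1 p.1.2, isCycle_pathCycle o ha hb hD _ _ p.2⟩
  have hf : Function.Bijective f := by
    constructor
    · intro p p' hp
      obtain ⟨h1, h2⟩ := pathCycle_injective ha hb (congrArg Subtype.val hp)
      exact Subtype.ext (Prod.ext h1 h2)
    · rintro ⟨z, hz⟩
      obtain ⟨s, l, h0, hz'⟩ := exists_pathCycle o ha hb hD hz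
      exact ⟨⟨(s, l), h0⟩, Subtype.ext hz'⟩
  refine o.arf_eq_of_sum (Equiv.ofBijective f hf) hc (Eq.trans ?_ h)
  have hout : o.out (.inr ⟨0, hb⟩, 2) = !o.out (.inl ⟨0, ha⟩, 3) := by
    have h := o.out_mate (.inl ⟨0, ha⟩, 3)
    simpa [hD, conwayMate] using h
  simp only [Equiv.ofBijective_apply, f]
  rw [← Finset.sum_subtype (Finset.univ.filter
    fun p : (Fin (a + 1) → ZMod 2) × (Fin (b + 1) → ZMod 2) => p.1 0 = p.2 0) (by simp)
    (fun p => signChar (o.seifertForm (pathCycle p.1 p.2))), Finset.sum_filter,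
    Fintype.sum_prod_type_right]
  simp only [signChar_seifertForm_pathCycle o ha hb hD he, hout]
  generalize o.out (.inl ⟨0, ha⟩, 3) = α, o.out (.inl ⟨0, ha⟩, 2) = β,
    o.out (.inr ⟨0, hb⟩, 1) = β'
  have hrow := fun l : Fin (b + 1) → ZMod 2 => sum_paths e (l 0 + l (Fin.last b)) a α β fun x y =>
    if x = l 0 then ∏ j : Fin b, signChar (crossingTerm (!e) (alternate (!α) β' j)
      (alternate β' (!α) j) (x + y) (l j.castSucc) (l j.succ)) else 0
  have hcol := fun x y => sum_paths (!e) (x + y) b (!α) β' fun p z =>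
    if x = p then twistMatrix e (p + z) α β a x y else 0
  simp only [ite_mul, zero_mul] at hrow hcol
  -- The edges of the row are summed first, with the column fixed, and then those of the column.
  simp only [mul_comm (∏ i : Fin a, _), hrow]
  rw [Finset.sum_comm]
  refine Finset.sum_congr rfl fun x _ => ?_
  rw [Finset.sum_comm]
  refine Finset.sum_congr rfl fun y _ => ?_
  simp only [mul_comm (∏ j : Fin b, _), hcol]
  rw [Finset.sum_comm]
  simp

/-- The relations between the directions of the strands at the first crossings of the two twists,
obtained by following the edges between the twists.  They decide which twist is parallel. -/
theorem out_closing_arcs (ha : 0 < a) (hb : 0 < b) (hD : D.mate = conwayMate a b ha hb) :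
    o.out (.inl ⟨0, ha⟩, 2) =
      alternate (o.out (.inr ⟨0, hb⟩, 1)) (!o.out (.inl ⟨0, ha⟩, 3)) (b - 1) ∧
    o.out (.inr ⟨0, hb⟩, 1) =
      alternate (o.out (.inl ⟨0, ha⟩, 2)) (o.out (.inl ⟨0, ha⟩, 3)) (a - 1) := by
  have h3 := o.out_mate (.inl ⟨0, ha⟩, 3)
  have h2 := o.out_mate (.inl ⟨0, ha⟩, 2)
  have h1 := o.out_mate (.inr ⟨0, hb⟩, 1)
  have p1 := o.out_opposite (.inr ⟨b - 1, by omega⟩) 1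
  have p0 := o.out_opposite (.inl ⟨a - 1, by omega⟩) 0
  simp only [hD, conwayMate, if_true, zero_add, Fin.reduceAdd] at h3 h2 h1 p1 p0
  have hr := (out_row o ha hb hD (a - 1) (by omega)).2
  have hc := (out_column o ha hb hD (b - 1) (by omega)).2
  rw [h3] at hc
  rw [← hr, ← hc]
  simp_all

theorem arf_even_even (ha : 0 < a) (hb : 0 < b) (hD : D.mate = conwayMate a b ha hb) {e : Bool}
    (he : ∀ c, D.overOdd c = e) {k h : ℕ} (hk : a = 2 * k) (hh : b = 2 * h) :
    o.arf = k * h := by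
  obtain ⟨k, rfl⟩ : ∃ k', k = k' + 1 := ⟨k - 1, by omega⟩
  obtain ⟨h, rfl⟩ : ∃ h', h = h' + 1 := ⟨h - 1, by omega⟩
  subst hk hh
  obtain ⟨h1, h2⟩ := out_closing_arcs o ha hb hD
  rw [alternate, if_neg (by rw [Nat.not_even_iff]; omega)] at h1 h2
  have := twistGaussSum_even_even e (o.out (.inl ⟨0, ha⟩, 3)) k h
  push_cast
  apply arf_eq_of_twistGaussSum o ha hb hD he
  rw [h1, h2]
  exact this

theorem arf_odd_even (ha : 0 < a) (hb : 0 < b) (hD : D.mate = conwayMate a b ha hb) {e : Bool}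
    (he : ∀ c, D.overOdd c = e) {k h : ℕ} (hk : a = 2 * k + 1) (hh : b = 2 * h) :
    o.arf = h * (k + 1) + h.choose 2 := by
  subst hk hh
  obtain ⟨h1, h2⟩ := out_closing_arcs o ha hb hD
  rw [alternate, if_neg (by rw [Nat.not_even_iff]; omega)] at h1
  rw [alternate, if_pos (by rw [Nat.even_iff]; omega)] at h2
  have := twistGaussSum_odd_even e (o.out (.inl ⟨0, ha⟩, 3)) k h
  rw [← h1] at this
  apply arf_eq_of_twistGaussSum o ha hb hD he
  rwa [h2]

theorem arf_even_odd (ha : 0 < a) (hb : 0 < b) (hD : D.mate = conwayMate a b ha hb) {e : Bool}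
    (he : ∀ c, D.overOdd c = e) {k h : ℕ} (hk : b = 2 * k + 1) (hh : a = 2 * h) :
    o.arf = h * (k + 1) + h.choose 2 := by
  subst hk hh
  obtain ⟨h1, h2⟩ := out_closing_arcs o ha hb hD
  rw [alternate, if_pos (by rw [Nat.even_iff]; omega)] at h1
  rw [alternate, if_neg (by rw [Nat.not_even_iff]; omega)] at h2
  have := twistGaussSum_odd_even (!e) (!o.out (.inl ⟨0, ha⟩, 3)) k h
  apply arf_eq_of_twistGaussSum o ha hb hD he
  rw [twistGaussSum_comm, h1, h2]
  simpa using this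

end LinkDiagram

/-! ### Residues modulo four -/

theorem natCast_zmod_two_eq {t r : ℕ} (h : t % 2 = r % 2) : (t : ZMod 2) = r :=
  (ZMod.natCast_eq_natCast_iff' t r 2).2 h

theorem choose_two_mod_two (h : ℕ) : h.choose 2 % 2 = h / 2 % 2 := by
  induction h with
  | zero => rfl
  | succ h ih =>
    rw [show (h + 1).choose 2 = h + h.choose 2 by
        rw [Nat.choose_succ_succ' h 1, Nat.choose_one_right]]
    have h4 : h % 4 = 0 ∨ h % 4 = 1 ∨ h % 4 = 2 ∨ h % 4 = 3 := by omega
    rcases h4 with h4 | h4 | h4 | h4 <;> omega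

/-- The case of an even `h`, where `h.choose 2` has the parity of `h / 2`. -/
theorem arf_formula_of_even (k : ℕ) {h r : ℕ} (h2 : h % 2 = 0) (hr : h / 2 % 2 = r % 2) :
    (h * (k + 1) + h.choose 2 : ZMod 2) = r := by
  rw [natCast_zmod_two_eq (r := 0) h2,
    natCast_zmod_two_eq ((choose_two_mod_two h).trans hr), Nat.cast_zero, zero_mul, zero_add]

theorem arf_formula_of_odd {k h r : ℕ} (h2 : h % 2 = 1) (hr : (2 * k + 1 + h) % 4 = 2 * r % 4) :
    (h * (k + 1) + h.choose 2 : ZMod 2) = r := by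
  rw [natCast_zmod_two_eq (r := 1) h2, Nat.cast_one, one_mul]
  have hc := choose_two_mod_two h
  exact_mod_cast natCast_zmod_two_eq (t := k + 1 + h.choose 2) (r := r) (by omega)

theorem theorem3p3 (m n : ℤ) (hm : m ≠ 0) (hn : n ≠ 0) (hmn : 0 < m * n)
    (o : (conwayDiagram m n hm hn).Orientation) :
    -- exactly one of `m`, `n` is even: first `n`, then `m`
    (Odd m → Even n →
      (n ≡ 0 [ZMOD 4] →
        (n / 2 ≡ 0 [ZMOD 4] → o.arf = 0) ∧ (n / 2 ≡ 2 [ZMOD 4] → o.arf = 1)) ∧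
      (n ≡ 2 [ZMOD 4] →
        (m + n / 2 ≡ 0 [ZMOD 4] → o.arf = 0) ∧ (m + n / 2 ≡ 2 [ZMOD 4] → o.arf = 1))) ∧
    (Even m → Odd n →
      (m ≡ 0 [ZMOD 4] →
        (m / 2 ≡ 0 [ZMOD 4] → o.arf = 0) ∧ (m / 2 ≡ 2 [ZMOD 4] → o.arf = 1)) ∧
      (m ≡ 2 [ZMOD 4] →
        (n + m / 2 ≡ 0 [ZMOD 4] → o.arf = 0) ∧ (n + m / 2 ≡ 2 [ZMOD 4] → o.arf = 1))) ∧
    -- both `m` and `n` are even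
    (Even m → Even n →
      (n ≡ 0 [ZMOD 4] → o.arf = 0) ∧
      (n ≡ 2 [ZMOD 4] →
        (m ≡ 0 [ZMOD 4] → o.arf = 0) ∧ (m ≡ 2 [ZMOD 4] → o.arf = 1))) := by
  have hsign : decide (0 < m) = decide (0 < n) := by
    rcases mul_pos_iff.1 hmn with h | h
    · simp [h.1, h.2]
    · simp [h.1.not_gt, h.2.not_gt]
  have he : ∀ c, (conwayDiagram m n hm hn).overOdd c = decide (0 < m) := by
    rintro (c | c)
    · rfl
    · exact hsign.symm
  have hs : (0 < m ∧ 0 < n) ∨ (m < 0 ∧ n < 0) := mul_pos_iff.1 hmn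
  have ha := Int.natAbs_pos.2 hm
  have hb := Int.natAbs_pos.2 hn
  simp only [Int.ModEq, Int.odd_iff, Int.even_iff]
  refine ⟨fun h1 h2 => ?_, fun h1 h2 => ?_, fun h1 h2 => ?_⟩
  · have harf := LinkDiagram.arf_odd_even o ha hb rfl he (k := m.natAbs / 2) (h := n.natAbs / 2)
      (by omega) (by omega)
    refine ⟨fun _ => ⟨fun _ => ?_, fun _ => ?_⟩, fun _ => ⟨fun _ => ?_, fun _ => ?_⟩⟩
    · exact harf.trans (arf_formula_of_even (r := 0) _ (by omega) (by omega))
    · exact harf.trans ((arf_formula_of_even (r := 1) _ (by omega) (by omega)).trans Nat.cast_one)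
    · exact harf.trans (arf_formula_of_odd (r := 0) (by omega) (by omega))
    · exact harf.trans ((arf_formula_of_odd (r := 1) (by omega) (by omega)).trans Nat.cast_one)
  · have harf := LinkDiagram.arf_even_odd o ha hb rfl he (k := n.natAbs / 2) (h := m.natAbs / 2)
      (by omega) (by omega)
    refine ⟨fun _ => ⟨fun _ => ?_, fun _ => ?_⟩, fun _ => ⟨fun _ => ?_, fun _ => ?_⟩⟩
    · exact harf.trans (arf_formula_of_even (r := 0) _ (by omega) (by omega))
    · exact harf.trans ((arf_formula_of_even (r := 1) _ (by omega) (by omega)).trans Nat.cast_one)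
    · exact harf.trans (arf_formula_of_odd (r := 0) (by omega) (by omega))
    · exact harf.trans ((arf_formula_of_odd (r := 1) (by omega) (by omega)).trans Nat.cast_one)
  · have harf := LinkDiagram.arf_even_even o ha hb rfl he (k := m.natAbs / 2) (h := n.natAbs / 2)
      (by omega) (by omega)
    refine ⟨fun _ => ?_, fun _ => ⟨fun _ => ?_, fun _ => ?_⟩⟩
    · rw [harf, natCast_zmod_two_eq (t := n.natAbs / 2) (r := 0) (by omega), Nat.cast_zero,
        mul_zero]
    · rw [harf, natCast_zmod_two_eq (t := m.natAbs / 2) (r := 0) (by omega), Nat.cast_zero,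
        zero_mul]
    · rw [harf, natCast_zmod_two_eq (t := m.natAbs / 2) (r := 1) (by omega),
        natCast_zmod_two_eq (t := n.natAbs / 2) (r := 1) (by omega), Nat.cast_one, mul_one]
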